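/- Let $X$ be a Hausdorff locally convex topological vector space over $\mathbb K\in\{\mathbb R,\mathbb C\}$, and let $M\subseteq X$ be nonempty, compact and convex. Let $A\colon M\to X$ be continuous, and let $B\colon D\to X$ be a map on a set $D$ with $M\subseteq D\subseteq X$ (for example $D=M$ or $D=X$) whose restriction to $M$ is continuous. Let $I$ denote the identity map. Assume that there is a sequence $(\lambda_n)$ in $\mathbb K$ with $\lambda_n\to 1$ such that the following hold. (a) For every $n$, the map $I-\lambda_nB$ is injective on $M$ and $A(M)\subseteq (I-\lambda_nB)(M)$. (b) For every $n$, if $u\in D$ satisfies $u=\lambda_nB(u)+A(v)$ for some $v\in M$, then $u\in M$. Then $A+B$ has a fixed point in $M$, that is, there is $u\in M$ with $A(u)+B(u)=u$. -/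

import Mathlib

open Filter Topology

/-! ### Scarf's combinatorial lemma -/

section Scarf

variable {V I α : Type*} [LinearOrder α]

/-! For each `n` the map `I - λₙB` is a homeomorphism of the compact set `M` onto its image, so `(I
- λₙB)⁻¹ ∘ A` is a continuous self-map of `M`. Schauder–Tychonoff gives `uₙ ∈ M` with `uₙ - λₙB(uₙ)
= A(uₙ)`, and compactness lets this equation pass to the limit `λₙ → 1`.

Schauder–Tychonoff follows from Brouwer on a simplex: a partition of unity yields a
finite-dimensional approximation whose fixed point moves by a vector in a prescribed convex
neighborhood of zero. Brouwer follows from Scarf's lemma, a parity argument that plays the role of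
Sperner's lemma: dominant sets of grid points in a simplex have small diameter, and a fully colored
one locates an almost fixed point. -/

/-- A set `S` is dominant for a family of orderings `v i` of `V` if no point of `V` lies, for every
`i`, strictly above the `v i`-minimum of `S`. -/
def IsDominant (v : I → V → α) (S : Finset V) : Prop :=
  ∀ y, ∃ i, ∀ s ∈ S, v i y ≤ v i s

theorem IsDominant.mono {v : I → V → α} {S T : Finset V} (hT : IsDominant v T) (h : S ⊆ T) :
    IsDominant v S := fun y => (hT y).imp fun _ hi s hs => hi s (h hs)

/-- `s i` is the bottom element of the ordering `v i`, and the other points `s j` lie above all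
points which are not of the form `s k`. -/
structure IsSlack (v : I → V → α) (s : I → V) : Prop where
  bot_le : ∀ i y, v i (s i) ≤ v i y
  lt : ∀ i j, i ≠ j → ∀ y, y ∉ Set.range s → v i y < v i (s j)

variable [Fintype V] [DecidableEq V] [Fintype I] [DecidableEq I]

open Finset in
/-- A dominant set of size `|I| - 1` that has a non-slack point extends to a dominant set by adding
one point in exactly two ways. -/
theorem IsDominant.exists_two_extensions {v : I → V → α} (hv : ∀ i, Function.Injective (v i))
    {s : I → V} (hs : IsSlack v s) {τ : Finset V} (hτ : IsDominant v τ)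
    (hcard : #τ + 1 = Fintype.card I) (y₀ : V) (hy₀ : y₀ ∈ τ) (hy₀s : y₀ ∉ Set.range s) :
    ∃ a b, a ≠ b ∧ ∀ x, (x ∉ τ ∧ IsDominant v (insert x τ)) ↔ (x = a ∨ x = b) := by
  classical
  have hm : ∀ i, ∃ m ∈ τ, ∀ t ∈ τ, v i m ≤ v i t := fun i =>
    exists_min_image τ (v i) ⟨y₀, hy₀⟩
  choose m hmτ hmin using hm
  have huniq : ∀ t ∈ τ, ∀ l, (∀ u ∈ τ, v l t ≤ v l u) → t = m l := fun t ht l h =>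
    hv l (le_antisymm (h _ (hmτ l)) (hmin l t ht))
  -- Dominance at a point of `τ` makes it the minimum for some order, so `m` maps `I` onto `τ`. As
  -- `|τ| = |I| - 1`, exactly one pair of indices collides.
  have hsurj : ∀ t ∈ τ, ∃ l, t = m l := fun t ht => by
    obtain ⟨l, hl⟩ := hτ t
    exact ⟨l, huniq t ht l hl⟩
  have hinj : ∀ k, (∀ t ∈ τ, ∃ l, l ≠ k ∧ t = m l) → Set.InjOn m {l | l ≠ k} := by
    intro k hk
    have himg : (univ.erase k).image m = τ := by
      ext t
      simp only [mem_image, mem_erase, mem_univ, and_true]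
      constructor
      · rintro ⟨l, -, rfl⟩
        exact hmτ l
      · intro ht
        obtain ⟨l, h1, h2⟩ := hk t ht
        exact ⟨l, h1, h2.symm⟩
    have : #((univ.erase k).image m) = #(univ.erase k) := by
      rw [himg, card_erase_of_mem (mem_univ _), card_univ]
      omega
    have h := card_image_iff.1 this
    intro a ha b hb hab
    exact h (by simpa using ha) (by simpa using hb) hab
  obtain ⟨i, j, hij, hmij⟩ : ∃ i j, i ≠ j ∧ m i = m j := by
    have hlt : #τ < #(univ : Finset I) := by rw [card_univ]; omega
    obtain ⟨i, -, j, -, hij, h⟩ := exists_ne_map_eq_of_card_lt_of_maps_to hlt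
      (f := m) (fun i _ => hmτ i)
    exact ⟨i, j, hij, h⟩
  -- The candidates for the new point, and the extension they give.
  have key : ∀ k k', k ≠ k' → m k = m k' → ∃ x, (∀ l, l ≠ k → v l (m l) < v l x) ∧
      (∀ y, (∀ l, l ≠ k → v l (m l) < v l y) → v k y ≤ v k x) ∧
      x ∉ τ ∧ IsDominant v (insert x τ) := by
    intro k k' hkk hmk
    have hsk : ∀ l, l ≠ k → v l (m l) < v l (s k) := fun l hl =>
      (hmin l y₀ hy₀).trans_lt (hs.lt l k hl y₀ hy₀s)
    obtain ⟨x, hx, hxmax⟩ := exists_max_image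
      (univ.filter fun y => ∀ l, l ≠ k → v l (m l) < v l y) (v k) ⟨s k, by simpa using hsk⟩
    simp only [mem_filter, mem_univ, true_and] at hx hxmax
    refine ⟨x, hx, hxmax, ?_, ?_⟩
    · intro hxτ
      obtain ⟨l, rfl⟩ := hsurj x hxτ
      by_cases hl : l = k
      · subst hl
        have := hx k' hkk.symm
        rw [hmk] at this
        exact lt_irrefl _ this
      · exact lt_irrefl _ (hx l hl)
    · intro y
      by_cases hy : ∀ l, l ≠ k → v l (m l) < v l y
      · obtain ⟨l, hl⟩ := hτ y
        have hlk : l = k := by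
          by_contra h
          exact absurd (hl _ (hmτ l)) (not_le.2 (hy l h))
        subst hlk
        refine ⟨l, fun t ht => ?_⟩
        rcases mem_insert.1 ht with rfl | ht
        · exact hxmax y hy
        · exact hl t ht
      · push Not at hy
        obtain ⟨l, hlk, hl⟩ := hy
        refine ⟨l, fun t ht => ?_⟩
        rcases mem_insert.1 ht with rfl | ht
        · exact hl.trans (hx l hlk).le
        · exact hl.trans (hmin l t ht)
  obtain ⟨a, haS, hamax, haτ, had⟩ := key i j hij hmij
  obtain ⟨b, hbS, hbmax, hbτ, hbd⟩ := key j i hij.symm hmij.symm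
  refine ⟨a, b, ?_, fun x => ⟨?_, ?_⟩⟩
  -- A common value would lie strictly above every minimum of `τ`, against dominance.
  · rintro rfl
    obtain ⟨l, hl⟩ := hτ a
    by_cases h : l = i
    · subst h
      exact absurd (hl _ (hmτ l)) (not_le.2 (hbS l hij))
    · exact absurd (hl _ (hmτ l)) (not_le.2 (haS l h))
  · rintro ⟨hxτ, hxd⟩
    -- The new point `x` is the minimum for the order `k`, so the points of `τ` are minima for the
    -- other orders. Hence `m` is injective off `k`, which forces `k` to be one of the colliding
    -- indices `i`, `j`.
    obtain ⟨k, hk⟩ := hxd x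
    have hlt : ∀ t ∈ τ, ∃ l, t = m l ∧ v l t < v l x := by
      intro t ht
      obtain ⟨l, hl⟩ := hxd t
      refine ⟨l, huniq t ht l fun u hu => hl u (mem_insert_of_mem hu), ?_⟩
      refine lt_of_le_of_ne (hl x (mem_insert_self _ _)) fun h => hxτ ?_
      rwa [← hv l h]
    have hkinj : Set.InjOn m {l | l ≠ k} := by
      refine hinj k fun t ht => ?_
      obtain ⟨l, h1, h2⟩ := hlt t ht
      refine ⟨l, ?_, h1⟩
      rintro rfl
      exact absurd (hk t (mem_insert_of_mem ht)) (not_le.2 h2)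
    have hxS : ∀ l, l ≠ k → v l (m l) < v l x := by
      intro l hl
      obtain ⟨l', h1, h2⟩ := hlt (m l) (hmτ l)
      have hl'k : l' ≠ k := by
        rintro rfl
        exact absurd (hk _ (mem_insert_of_mem (hmτ l))) (not_le.2 h2)
      rwa [← hkinj hl hl'k h1] at h2
    have hxmax : ∀ y, (∀ l, l ≠ k → v l (m l) < v l y) → v k y ≤ v k x := by
      intro y hy
      obtain ⟨l, hl⟩ := hxd y
      have hlk : l = k := by
        by_contra h
        exact absurd (hl _ (mem_insert_of_mem (hmτ l))) (not_le.2 (hy l h))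
      subst hlk
      exact hl x (mem_insert_self _ _)
    by_cases hki : k = i
    · subst hki
      exact Or.inl (hv k (le_antisymm (hamax x hxS) (hxmax a haS)))
    · by_cases hkj : k = j
      · subst hkj
        exact Or.inr (hv k (le_antisymm (hbmax x hxS) (hxmax b hbS)))
      · exact absurd (hkinj (Ne.symm hki) (Ne.symm hkj) hmij) hij
  · rintro (rfl | rfl)
    exacts [⟨haτ, had⟩, ⟨hbτ, hbd⟩]

open Finset in
/-- The set of all slack points but one extends to a dominant set in exactly one way. -/
theorem IsSlack.exists_one_extension {v : I → V → α} (hv : ∀ i, Function.Injective (v i))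
    {s : I → V} (hs : IsSlack v s) (hne : ∃ y, y ∉ Set.range s) (i₀ : I) :
    ∃ a, ∀ x, (x ∉ (univ.erase i₀).image s ∧
      IsDominant v (insert x ((univ.erase i₀).image s))) ↔ x = a := by
  classical
  obtain ⟨y₀, hy₀⟩ := hne
  obtain ⟨a, ha, hamax⟩ := exists_max_image (univ.filter fun y => y ∉ Set.range s) (v i₀)
    ⟨y₀, by simpa using hy₀⟩
  simp only [mem_filter, mem_univ, true_and] at ha hamax
  -- For `i ≠ i₀` the bottom element `s i` is in the set, so only the order `i₀` can witness
  -- dominance at a non-slack point.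
  have hforce : ∀ x y, y ∉ Set.range s → (∃ i, ∀ t ∈ insert x ((univ.erase i₀).image s),
      v i y ≤ v i t) → v i₀ y ≤ v i₀ x := by
    rintro x y hy ⟨i, hi⟩
    by_cases h : i = i₀
    · subst h
      exact hi x (mem_insert_self _ _)
    · have h1 := hi (s i) (mem_insert_of_mem (mem_image_of_mem _ (by simpa using h)))
      have := hv i (le_antisymm h1 (hs.bot_le i y))
      exact absurd ⟨i, this.symm⟩ hy
  refine ⟨a, fun x => ⟨?_, ?_⟩⟩
  · rintro ⟨hx, hd⟩
    have h1 := hforce x a ha (hd a)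
    have hxs : x ∉ Set.range s := by
      rintro ⟨k, rfl⟩
      have hk : k = i₀ := by
        by_contra h
        exact hx (mem_image_of_mem _ (by simpa using h))
      subst hk
      exact ha ⟨k, (hv k (le_antisymm h1 (hs.bot_le k a))).symm⟩
    exact hv i₀ (le_antisymm (hamax x hxs) h1)
  · rintro rfl
    refine ⟨fun h => ?_, fun y => ?_⟩
    · obtain ⟨k, -, rfl⟩ := mem_image.1 h
      exact ha ⟨k, rfl⟩
    · by_cases hy : y ∈ Set.range s
      · obtain ⟨k, rfl⟩ := hy
        exact ⟨k, fun t _ => hs.bot_le k t⟩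
      · refine ⟨i₀, fun t ht => ?_⟩
        rcases mem_insert.1 ht with rfl | ht
        · exact hamax y hy
        · obtain ⟨k, hk, rfl⟩ := mem_image.1 ht
          exact (hs.lt i₀ k (by simpa using Ne.symm (ne_of_mem_erase hk)) y hy).le

open Finset in
/-- In a finite set with one element more than colors other than `i₀`, the number of points whose
removal leaves exactly these colors is even, unless all colors occur. -/
theorem even_card_erase_image_eq (c : V → I) (i₀ : I) {σ : Finset V}
    (hσ : #σ = Fintype.card I) (hc : σ.image c ≠ univ) :
    Even #(univ.filter fun τ : Finset V =>
      (#τ + 1 = Fintype.card I ∧ τ.image c = univ.erase i₀) ∧ τ ⊆ σ) := by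
  classical
  rcases eq_empty_or_nonempty (univ.filter fun τ : Finset V =>
      (#τ + 1 = Fintype.card I ∧ τ.image c = univ.erase i₀) ∧ τ ⊆ σ) with h | ⟨τ, h⟩
  · simp [h]
  simp only [mem_filter, mem_univ, true_and] at h
  obtain ⟨⟨hτc, hτi⟩, hτσ⟩ := h
  have hins : ∀ τ : Finset V, #τ + 1 = Fintype.card I → τ ⊆ σ → ∃ x ∉ τ, σ = insert x τ := by
    intro τ h1 h2
    obtain ⟨x, hx, h⟩ := exists_eq_insert_iff.2 ⟨h2, h1.trans hσ.symm⟩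
    exact ⟨x, hx, h.symm⟩
  have hinj : ∀ τ : Finset V, #τ + 1 = Fintype.card I → τ.image c = univ.erase i₀ →
      Set.InjOn c τ := by
    intro τ h1 h2
    refine card_image_iff.1 ?_
    rw [h2, card_erase_of_mem (mem_univ _), card_univ]
    omega
  -- The color of `x` repeats that of a unique `x' ∈ τ`; only the removal of `x` or of `x'` keeps
  -- all colors but `i₀`.
  obtain ⟨x, hxτ, rfl⟩ := hins τ hτc hτσ
  have hcx : c x ∈ τ.image c := by
    rw [hτi]
    refine mem_erase.2 ⟨fun h => hc ?_, mem_univ _⟩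
    rw [image_insert, hτi, h, insert_erase (mem_univ _)]
  obtain ⟨x', hx', hcx'⟩ := mem_image.1 hcx
  have hxx' : x ≠ x' := by
    rintro rfl
    exact hxτ hx'
  have hset : (univ.filter fun τ' : Finset V =>
      (#τ' + 1 = Fintype.card I ∧ τ'.image c = univ.erase i₀) ∧ τ' ⊆ insert x τ) =
      {τ, (insert x τ).erase x'} := by
    ext τ'
    simp only [mem_filter, mem_univ, true_and, mem_insert, mem_singleton]
    constructor
    · rintro ⟨⟨h1, h2⟩, h3⟩
      obtain ⟨z, hz, hze⟩ := hins τ' h1 h3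
      have hτ' : τ' = (insert x τ).erase z := by rw [hze, erase_insert hz]
      by_cases hzx : z = x
      · left
        rw [hτ', hzx, erase_insert hxτ]
      · by_cases hzx' : z = x'
        · right
          rw [hτ', hzx']
        · refine absurd (hinj τ' h1 h2 ?_ ?_ hcx'.symm) hxx'
          · rw [hτ']
            exact mem_coe.2 (mem_erase.2 ⟨Ne.symm hzx, mem_insert_self _ _⟩)
          · rw [hτ']
            exact mem_coe.2 (mem_erase.2 ⟨Ne.symm hzx', mem_insert_of_mem hx'⟩)
    · rintro (rfl | rfl)
      · exact ⟨⟨hτc, hτi⟩, hτσ⟩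
      · refine ⟨⟨?_, ?_⟩, erase_subset _ _⟩
        · rw [card_erase_of_mem (mem_insert_of_mem hx'), card_insert_of_notMem hxτ]
          omega
        · rw [← hτi]
          ext i
          simp only [mem_image, mem_erase, mem_insert]
          constructor
          · rintro ⟨u, ⟨hu, rfl | hu'⟩, rfl⟩
            · exact ⟨x', hx', hcx'⟩
            · exact ⟨u, hu', rfl⟩
          · rintro ⟨u, hu, rfl⟩
            by_cases hux : u = x'
            · exact ⟨x, ⟨hxx', Or.inl rfl⟩, by rw [hux, hcx']⟩
            · exact ⟨u, ⟨hux, Or.inr hu⟩, rfl⟩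
  rw [hset, card_pair]
  · exact even_two
  · intro h
    have : x' ∈ (insert x τ).erase x' := h ▸ hx'
    simp at this

open Finset in
/-- **Scarf's lemma**: every coloring in which the slack points have their own color admits a
dominant set in which each color occurs exactly once. -/
theorem exists_isDominant_image_eq_univ [Nonempty I] {v : I → V → α}
    (hv : ∀ i, Function.Injective (v i)) {s : I → V} (hs : IsSlack v s)
    (hne : ∃ y, y ∉ Set.range s) (c : V → I) (hc : ∀ i, c (s i) = i) :
    ∃ σ : Finset V, #σ = Fintype.card I ∧ IsDominant v σ ∧ σ.image c = univ := by
  classical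
  by_contra! hcon
  obtain ⟨i₀⟩ := ‹Nonempty I›
  have hsinj : Function.Injective s := Function.LeftInverse.injective hc
  -- Count incidences mod 2: without a fully colored room every room has an even number of doors,
  -- whereas `τ₀` lies in one room and any other door in two.
  set doors := univ.filter fun τ : Finset V => IsDominant v τ ∧
    (#τ + 1 = Fintype.card I ∧ τ.image c = univ.erase i₀) with hdoors
  set rooms := univ.filter fun σ : Finset V => #σ = Fintype.card I ∧ IsDominant v σ with hrooms
  have hcount := sum_card_bipartiteAbove_eq_sum_card_bipartiteBelow (s := doors) (t := rooms)
    (fun τ σ => τ ⊆ σ)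
  have heven : Even (∑ σ ∈ rooms, #(doors.bipartiteBelow (fun τ σ => τ ⊆ σ) σ)) := by
    refine even_sum _ fun σ hσ => ?_
    simp only [hrooms, mem_filter, mem_univ, true_and] at hσ
    have := even_card_erase_image_eq c i₀ hσ.1 (hcon σ hσ.1 hσ.2)
    convert this using 2
    congr 1
    ext τ
    simp only [bipartiteBelow, hdoors, mem_filter, mem_univ, true_and]
    exact ⟨fun h => ⟨h.1.2, h.2⟩, fun h => ⟨⟨hσ.2.mono h.2, h.1⟩, h.2⟩⟩
  have habove : ∀ τ ∈ doors, rooms.bipartiteAbove (fun τ σ => τ ⊆ σ) τ =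
      (univ.filter fun x => x ∉ τ ∧ IsDominant v (insert x τ)).image fun x => insert x τ := by
    intro τ hτ
    simp only [hdoors, mem_filter, mem_univ, true_and] at hτ
    ext σ
    simp only [bipartiteAbove, hrooms, mem_filter, mem_univ, true_and, mem_image]
    constructor
    · rintro ⟨⟨h1, h2⟩, h3⟩
      obtain ⟨x, hx, rfl⟩ := exists_eq_insert_iff.2 ⟨h3, hτ.2.1.trans h1.symm⟩
      exact ⟨x, ⟨hx, h2⟩, rfl⟩
    · rintro ⟨x, ⟨h1, h2⟩, rfl⟩
      exact ⟨⟨by rw [card_insert_of_notMem h1, hτ.2.1], h2⟩, subset_insert _ _⟩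
  set τ₀ := (univ.erase i₀).image s with hτ₀
  obtain ⟨a, ha⟩ := hs.exists_one_extension hv hne i₀
  have hτ₀mem : τ₀ ∈ doors := by
    simp only [hdoors, mem_filter, mem_univ, true_and]
    refine ⟨((ha a).2 rfl).2.mono (subset_insert _ _), ?_, ?_⟩
    · rw [hτ₀, card_image_of_injective _ hsinj, card_erase_add_one (mem_univ _), card_univ]
    · rw [hτ₀, image_image, show c ∘ s = id from funext hc, image_id]
  have hone : #(rooms.bipartiteAbove (fun τ σ => τ ⊆ σ) τ₀) = 1 := by
    rw [habove τ₀ hτ₀mem]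
    have : (univ.filter fun x => x ∉ τ₀ ∧ IsDominant v (insert x τ₀)) = {a} := by
      ext x
      simp only [mem_filter, mem_univ, true_and, mem_singleton]
      exact ha x
    rw [this, image_singleton, card_singleton]
  have htwo : ∀ τ ∈ doors.erase τ₀, Even #(rooms.bipartiteAbove (fun τ σ => τ ⊆ σ) τ) := by
    intro τ hτ
    obtain ⟨hττ₀, hτd⟩ := mem_erase.1 hτ
    rw [habove τ hτd]
    simp only [hdoors, mem_filter, mem_univ, true_and] at hτd
    -- Slack points carry their own colors, so a door made only of slack points is `τ₀`.
    have hy : ∃ y ∈ τ, y ∉ Set.range s := by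
      by_contra! hall
      refine hττ₀ (hτ₀ ▸ ?_)
      ext y
      rw [← hτd.2.2]
      simp only [mem_image]
      constructor
      · intro hy
        obtain ⟨k, rfl⟩ := hall y hy
        exact ⟨k, ⟨s k, hy, hc k⟩, rfl⟩
      · rintro ⟨k, ⟨z, hz, rfl⟩, rfl⟩
        obtain ⟨k, rfl⟩ := hall z hz
        rwa [hc k]
    obtain ⟨y, hyτ, hys⟩ := hy
    obtain ⟨p, q, hpq, h⟩ := hτd.1.exists_two_extensions hv hs hτd.2.1 y hyτ hys
    have hset : (univ.filter fun x => x ∉ τ ∧ IsDominant v (insert x τ)) = {p, q} := by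
      ext x
      simp only [mem_filter, mem_univ, true_and, mem_singleton, mem_insert]
      exact h x
    have hp := ((h p).2 (Or.inl rfl)).1
    have hpq' : insert p τ ≠ insert q τ := fun he => by
      have : p ∈ insert q τ := he ▸ mem_insert_self _ _
      rcases mem_insert.1 this with h' | h'
      exacts [hpq h', hp h']
    rw [hset, image_insert, image_singleton, card_pair hpq']
    exact even_two
  rw [← hcount, ← add_sum_erase _ _ hτ₀mem, hone] at heven
  have := even_sum _ htwo
  rw [Nat.even_add] at heven
  exact absurd (heven.2 this) (by decide)

end Scarf

/-! ### Brouwer's theorem on the simplex -/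

section Brouwer

variable {I : Type*} [Fintype I]

open Finset in
/-- For every coloring of the points of `ℕ^I` with coordinate sum `N` there is a small set of such
points in which every color `i` occurs, unless the `i`-th coordinate is small there. -/
theorem exists_close_points_of_coloring [Nonempty I] (N : ℕ) (c : (I → ℕ) → I) :
    ∃ p : I → ℕ, ∑ j, p j = N ∧ ∀ i, ∃ y : I → ℕ, ∑ j, y j = N ∧
      (∀ j, y j ≤ p j + Fintype.card I ∧ p j ≤ y j + Fintype.card I) ∧
      (c y = i ∨ y i ≤ Fintype.card I) := by
  classical
  let T := {y : I → ℕ // y ∈ piAntidiag univ N}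
  let _ : Fintype T := Finset.Subtype.fintype _
  have hT : ∀ y : I → ℕ, y ∈ piAntidiag univ N ↔ ∑ j, y j = N := by simp
  -- Grid points get values in `[1, N + 1]`, strictly between the two slack values `0` and `N + 2`.
  -- The enumeration `e` breaks ties.
  let a : I → T ⊕ I → ℕ := fun i => Sum.elim (fun y => y.1 i + 1) fun j => if i = j then 0 else N + 2
  let e := Fintype.equivFin (T ⊕ I)
  let v : I → T ⊕ I → ℕ ×ₗ Fin (Fintype.card (T ⊕ I)) := fun i t => toLex (a i t, e t)
  have hle : ∀ i t t', v i t ≤ v i t' → a i t ≤ a i t' := fun i t t' h =>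
    Prod.Lex.monotone_fst _ _ h
  have hlt : ∀ i t t', a i t < a i t' → v i t < v i t' := fun i t t' h =>
    Prod.Lex.toLex_lt_toLex.2 (Or.inl h)
  have hv : ∀ i, Function.Injective (v i) := fun i t t' h =>
    e.injective (congrArg (fun z => (ofLex z).2) h)
  have hs : IsSlack v (Sum.inr : I → T ⊕ I) := by
    constructor
    · rintro i (y | j)
      · exact (hlt _ _ _ (by simp [a])).le
      · by_cases h : i = j
        · rw [h]
        · exact (hlt _ _ _ (by simp [a, h])).le
    · rintro i j hij (y | k) hy
      · refine hlt _ _ _ ?_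
        have := single_le_sum (f := y.1) (fun _ _ => Nat.zero_le _) (mem_univ i)
        rw [(hT _).1 y.2] at this
        simp only [a, Sum.elim_inl, Sum.elim_inr, if_neg hij]
        omega
      · exact absurd ⟨k, rfl⟩ hy
  obtain ⟨i₁⟩ := id ‹Nonempty I›
  have y₁ : T := ⟨Pi.single i₁ N, (hT _).2 (by simp)⟩
  obtain ⟨σ, -, hd, hcol⟩ := exists_isDominant_image_eq_univ hv hs ⟨Sum.inl y₁, by simp⟩
    (Sum.elim (fun y => c y.1) id) fun i => rfl
  have hdom : ∀ y : T, ∃ i, Sum.inr i ∉ σ ∧ ∀ t : T, Sum.inl t ∈ σ → y.1 i ≤ t.1 i := by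
    intro y
    obtain ⟨i, hi⟩ := hd (Sum.inl y)
    refine ⟨i, fun h => ?_, fun t ht => ?_⟩
    · simpa [a] using hle _ _ _ (hi _ h)
    · simpa [a] using hle _ _ _ (hi _ ht)
  have hocc : ∀ i, Sum.inr i ∉ σ → ∃ t : T, Sum.inl t ∈ σ ∧ c t.1 = i := by
    intro i hi
    obtain ⟨t | j, ht, h⟩ := mem_image.1 (hcol ▸ mem_univ i)
    · exact ⟨t, ht, h⟩
    · obtain rfl : j = i := h
      exact absurd ht hi
  obtain ⟨i₂, hi₂, -⟩ := hdom y₁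
  obtain ⟨p, hp, -⟩ := hocc i₂ hi₂
  have hmin : ∀ i, ∃ q : T, Sum.inl q ∈ σ ∧ ∀ t : T, Sum.inl t ∈ σ → q.1 i ≤ t.1 i := by
    intro i
    obtain ⟨q, hq, h⟩ := exists_min_image (univ.filter fun t : T => Sum.inl t ∈ σ)
      (fun t => t.1 i) ⟨p, by simpa using hp⟩
    exact ⟨q, by simpa using hq, fun t ht => h t (by simpa using ht)⟩
  choose q hq hqmin using hmin
  let m : I → ℕ := fun i => if Sum.inr i ∈ σ then 0 else (q i).1 i
  have hm : ∀ (t : T) i, Sum.inl t ∈ σ → m i ≤ t.1 i := by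
    intro t i ht
    simp only [m]
    split_ifs
    exacts [Nat.zero_le _, hqmin i t ht]
  -- Otherwise `m + 1`, with the surplus put on coordinate `i₁`, is a grid point exceeding all
  -- relevant minima, against dominance. Since coordinates sum to `N`, none can then exceed `m` by
  -- `|I|` or more.
  have hsum : N < ∑ i, m i + Fintype.card I := by
    by_contra! h
    let y : I → ℕ := fun i => m i + 1 + if i = i₁ then N - (∑ i, m i + Fintype.card I) else 0
    have hy : ∑ i, y i = N := by
      simp only [y, sum_add_distrib, sum_const, card_univ, smul_eq_mul, mul_one,
        sum_ite_eq', mem_univ, if_true]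
      omega
    obtain ⟨i, hi, h'⟩ := hdom ⟨y, (hT y).2 hy⟩
    have := h' _ (hq i)
    simp only [y, m, if_neg hi] at this
    omega
  have hub : ∀ (t : T) i, Sum.inl t ∈ σ → t.1 i < m i + Fintype.card I := by
    intro t i ht
    have h1 := (hT _).1 t.2
    have h2 : ∑ j ∈ univ.erase i, m j ≤ ∑ j ∈ univ.erase i, t.1 j :=
      sum_le_sum fun j _ => hm t j ht
    rw [← add_sum_erase _ _ (mem_univ i)] at h1 hsum
    omega
  refine ⟨p.1, (hT _).1 p.2, fun i => ?_⟩
  have hclose : ∀ t : T, Sum.inl t ∈ σ →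
      ∀ j, t.1 j ≤ p.1 j + Fintype.card I ∧ p.1 j ≤ t.1 j + Fintype.card I := by
    intro t ht j
    have h1 := hm t j ht
    have h2 := hm p j hp
    have h3 := hub t j ht
    have h4 := hub p j hp
    omega
  by_cases hi : Sum.inr i ∈ σ
  · refine ⟨p.1, (hT _).1 p.2, hclose p hp, Or.inr ?_⟩
    have := hub p i hp
    simp only [m, if_pos hi] at this
    omega
  · obtain ⟨t, ht, hti⟩ := hocc i hi
    exact ⟨t.1, (hT _).1 t.2, hclose t ht, Or.inl hti⟩

/-- Close to some point of the simplex, a self-map almost increases each of the coordinates. -/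
theorem exists_close_points_le_apply {f : (I → ℝ) → I → ℝ}
    [Nonempty I] (hf : Set.MapsTo f (stdSimplex ℝ I) (stdSimplex ℝ I)) {ε : ℝ} (hε : 0 < ε) :
    ∃ x ∈ stdSimplex ℝ I, ∀ i, ∃ z ∈ stdSimplex ℝ I, dist z x ≤ ε ∧ z i ≤ f z i + ε := by
  obtain ⟨N, hN⟩ := exists_nat_gt ((Fintype.card I : ℝ) / ε)
  have hN0 : (0 : ℝ) < N := lt_of_le_of_lt (by positivity) hN
  have hNε : (Fintype.card I : ℝ) / N ≤ ε := by
    rw [div_lt_iff₀ hε] at hN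
    rw [div_le_iff₀ hN0]
    linarith
  let g : (I → ℕ) → I → ℝ := fun y j => y j / N
  have hg : ∀ y : I → ℕ, ∑ j, y j = N → g y ∈ stdSimplex ℝ I := by
    intro y hy
    refine ⟨fun j => by positivity, ?_⟩
    rw [← Finset.sum_div, ← Nat.cast_sum, hy, div_self hN0.ne']
  -- Both `g y` and `f (g y)` have coordinate sum `1`, so some coordinate does not decrease.
  have hcol : ∀ y : I → ℕ, ∃ i, ∑ j, y j = N → g y i ≤ f (g y) i := by
    intro y
    by_cases hy : ∑ j, y j = N
    · obtain ⟨i, -, hi⟩ := Finset.exists_le_of_sum_le (s := Finset.univ) (f := g y)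
        (g := f (g y)) Finset.univ_nonempty (by rw [(hg y hy).2, (hf (hg y hy)).2])
      exact ⟨i, fun _ => hi⟩
    · exact ⟨Classical.arbitrary I, fun h => absurd h hy⟩
  choose c hc using hcol
  obtain ⟨p, hp, h⟩ := exists_close_points_of_coloring N c
  refine ⟨g p, hg p hp, fun i => ?_⟩
  obtain ⟨y, hy, hclose, hor⟩ := h i
  refine ⟨g y, hg y hy, (dist_pi_le_iff hε.le).2 fun j => ?_, ?_⟩
  · refine le_trans ?_ hNε
    have h1 : (y j : ℝ) ≤ p j + Fintype.card I := by exact_mod_cast (hclose j).1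
    have h2 : (p j : ℝ) ≤ y j + Fintype.card I := by exact_mod_cast (hclose j).2
    rw [Real.dist_eq, ← sub_div, abs_div, abs_of_pos hN0]
    gcongr
    exact abs_le.2 ⟨by linarith, by linarith⟩
  · rcases hor with rfl | hi
    · linarith [hc y hy]
    · have h1 : g y i ≤ (Fintype.card I : ℝ) / N := by
        simp only [g]
        gcongr
      linarith [(hf (hg y hy)).1 i]

/-- **Brouwer's fixed point theorem** for the standard simplex. -/
theorem exists_fixedPoint_stdSimplex [Nonempty I] {f : (I → ℝ) → I → ℝ}
    (hfc : ContinuousOn f (stdSimplex ℝ I))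
    (hf : Set.MapsTo f (stdSimplex ℝ I) (stdSimplex ℝ I)) :
    ∃ x ∈ stdSimplex ℝ I, f x = x := by
  have hcpt : IsCompact (stdSimplex ℝ I) := isCompact_stdSimplex ℝ I
  -- A zero of `g` satisfies `x ≤ f x` coordinatewise, and equal sums force equality. The image of
  -- `g` is compact, so approximate zeros suffice.
  let g : (I → ℝ) → I → ℝ := fun x i => max 0 (x i - f x i)
  have hgc : ContinuousOn g (stdSimplex ℝ I) := by
    refine continuousOn_pi.2 fun i => ?_
    have h1 : ContinuousOn (fun x => f x i) (stdSimplex ℝ I) := continuousOn_pi.1 hfc i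
    have h2 : ContinuousOn (fun x : I → ℝ => x i) (stdSimplex ℝ I) :=
      (continuous_apply i).continuousOn
    exact continuousOn_const.sup (h2.sub h1)
  have hmem : (0 : I → ℝ) ∈ g '' stdSimplex ℝ I := by
    rw [← (hcpt.image_of_continuousOn hgc).isClosed.closure_eq, Metric.mem_closure_iff]
    intro ε hε
    -- Three errors of at most `ε / 4` add up: `x - z`, `z - f z` and `f z - f x`.
    obtain ⟨δ, hδ, hδf⟩ := Metric.uniformContinuousOn_iff.1
      (hcpt.uniformContinuousOn_of_continuous hfc) (ε / 4) (by positivity)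
    obtain ⟨x, hx, h⟩ := exists_close_points_le_apply hf
      (show 0 < min (δ / 2) (ε / 4) by positivity)
    refine ⟨g x, ⟨x, hx, rfl⟩, (dist_pi_lt_iff hε).2 fun i => ?_⟩
    obtain ⟨z, hz, hzx, hzi⟩ := h i
    have h1 : dist z x < δ := by
      linarith [hzx.trans (min_le_left _ _)]
    have h2 := (dist_le_pi_dist z x i).trans (hzx.trans (min_le_right _ _))
    have h3 := (dist_le_pi_dist (f z) (f x) i).trans (hδf z hz x hx h1).le
    rw [Real.dist_eq] at h2 h3
    rw [Pi.zero_apply, dist_comm, Real.dist_0_eq_abs, abs_of_nonneg (le_max_left _ _)]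
    refine max_lt hε ?_
    linarith [(abs_le.1 h2).1, (abs_le.1 h3).2, hzi, min_le_right (δ / 2) (ε / 4)]
  obtain ⟨x, hx, hgx⟩ := hmem
  refine ⟨x, hx, ?_⟩
  have hle : ∀ i ∈ Finset.univ, x i ≤ f x i := by
    intro i _
    have h1 := congrFun hgx i
    have h2 : x i - f x i ≤ g x i := le_max_right _ _
    rw [h1, Pi.zero_apply] at h2
    linarith
  have := (Finset.sum_eq_sum_iff_of_le hle).1 (by rw [hx.2, (hf hx).2])
  exact funext fun i => (this i (Finset.mem_univ i)).symm

end Brouwer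

/-! ### The Schauder–Tychonoff theorem and a coincidence theorem -/

section Schauder

variable {X : Type*} [AddCommGroup X] [Module ℝ X] [TopologicalSpace X] [IsTopologicalAddGroup X]
  [ContinuousSMul ℝ X] [T2Space X] {M : Set X}

/-- A continuous self-map of a compact convex set has almost fixed points, up to any given convex
neighborhood of zero. -/
theorem exists_sub_apply_mem_of_convex (hne : M.Nonempty) (hcpt : IsCompact M)
    (hconv : Convex ℝ M) {f : M → M} (hf : Continuous f) {V : Set X} (hVo : IsOpen V)
    (hV0 : (0 : X) ∈ V) (hV : Convex ℝ V) : ∃ x : M, (x : X) - f x ∈ V := by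
  have : CompactSpace M := isCompact_iff_compactSpace.1 hcpt
  have hUo : ∀ y : M, IsOpen {z : M | (y : X) - z ∈ V} := fun y =>
    hVo.preimage (continuous_const.sub continuous_subtype_val)
  obtain ⟨t, ht⟩ := isCompact_univ.elim_finite_subcover (fun y : M => {z : M | (y : X) - z ∈ V})
    hUo fun z _ => Set.mem_iUnion.2 ⟨z, by simpa using hV0⟩
  obtain ⟨ρ, hρ⟩ := PartitionOfUnity.exists_isSubordinate isClosed_univ
    (fun y : t => {z : M | ((y : M) : X) - z ∈ V}) (fun y => hUo y)
    (by simpa [Set.iUnion_subtype] using ht)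
  have : Nonempty t := by
    obtain ⟨z, hz⟩ := hne
    obtain ⟨y, hy⟩ := Set.mem_iUnion.1 (ht (Set.mem_univ ⟨z, hz⟩))
    obtain ⟨hyt, -⟩ := Set.mem_iUnion.1 hy
    exact ⟨⟨y, hyt⟩⟩
  let ψ : M → t → ℝ := fun z i => ρ i z
  have hψc : Continuous ψ := continuous_pi fun i => (ρ i).continuous
  have hψ : ∀ z, ψ z ∈ stdSimplex ℝ t := fun z =>
    ⟨fun i => ρ.nonneg i z, by
      rw [← finsum_eq_sum_of_fintype]
      exact ρ.sum_eq_one (Set.mem_univ z)⟩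
  let φ : (t → ℝ) → X := fun w => ∑ i, w i • ((i : M) : X)
  have hφc : Continuous φ := continuous_finsetSum _ fun i _ =>
    (continuous_apply i).smul continuous_const
  have hφ : ∀ w ∈ stdSimplex ℝ t, φ w ∈ M := fun w hw =>
    hconv.sum_mem (fun i _ => hw.1 i) hw.2 fun i _ => (i : M).2
  classical
  -- On the simplex this is `ψ ∘ f ∘ φ`; the value `0` elsewhere is arbitrary.
  let g : (t → ℝ) → t → ℝ := fun w =>
    if hw : w ∈ stdSimplex ℝ t then ψ (f ⟨φ w, hφ w hw⟩) else 0
  have hg : ∀ w (hw : w ∈ stdSimplex ℝ t), g w = ψ (f ⟨φ w, hφ w hw⟩) := fun w hw => dif_pos hw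
  have hgc : ContinuousOn g (stdSimplex ℝ t) := by
    rw [continuousOn_iff_continuous_domRestrict]
    have : (stdSimplex ℝ t).domRestrict g = fun w : stdSimplex ℝ t => ψ (f ⟨φ w, hφ w w.2⟩) :=
      funext fun w => hg w w.2
    rw [this]
    exact hψc.comp (hf.comp ((hφc.comp continuous_subtype_val).subtype_mk _))
  obtain ⟨w, hw, hgw⟩ := exists_fixedPoint_stdSimplex hgc fun w hw => by
    rw [hg w hw]
    exact hψ _
  rw [hg w hw] at hgw
  set x : M := ⟨φ w, hφ w hw⟩ with hx
  refine ⟨x, ?_⟩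
  -- As `x = φ (ψ (f x))`, this is a convex combination of vectors `i - f x`, and those with nonzero
  -- weight lie in `V`.
  have hsum : (x : X) - f x = ∑ᶠ i : t, ψ (f x) i • (((i : M) : X) - f x) := by
    rw [finsum_eq_sum_of_fintype]
    simp only [smul_sub, Finset.sum_sub_distrib]
    rw [← Finset.sum_smul, (hψ (f x)).2, one_smul, hgw]
  rw [hsum]
  refine hV.finsum_mem (fun i => ρ.nonneg i _) (ρ.sum_eq_one (Set.mem_univ _)) fun i hi => ?_
  exact hρ i (subset_tsupport _ hi)

/-- **Schauder–Tychonoff fixed point theorem**. -/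
theorem exists_fixedPoint_of_isCompact_convex [LocallyConvexSpace ℝ X] (hne : M.Nonempty)
    (hcpt : IsCompact M) (hconv : Convex ℝ M) {f : M → M} (hf : Continuous f) :
    ∃ x, f x = x := by
  have : CompactSpace M := isCompact_iff_compactSpace.1 hcpt
  have hgc : Continuous fun x : M => (x : X) - f x :=
    continuous_subtype_val.sub (continuous_subtype_val.comp hf)
  have h0 : (0 : X) ∈ Set.range fun x : M => (x : X) - f x := by
    rw [← (isCompact_range hgc).isClosed.closure_eq,
      mem_closure_iff_nhds_basis (LocallyConvexSpace.convex_open_basis_zero ℝ X)]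
    rintro V ⟨hV0, hVo, hV⟩
    obtain ⟨x, hx⟩ := exists_sub_apply_mem_of_convex hne hcpt hconv hf hVo hV0 hV
    exact ⟨_, ⟨x, rfl⟩, hx⟩
  obtain ⟨x, hx⟩ := h0
  exact ⟨x, Subtype.ext (sub_eq_zero.1 hx).symm⟩

/-- A continuous map whose values are taken by a continuous injective map `h` on a compact convex
set `M` coincides with `h` somewhere on `M`. -/
theorem exists_eq_of_injOn_of_image_subset [LocallyConvexSpace ℝ X] {Y : Type*}
    [TopologicalSpace Y] [T2Space Y] (hne : M.Nonempty) (hcpt : IsCompact M) (hconv : Convex ℝ M)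
    {A h : X → Y} (hA : ContinuousOn A M) (hh : ContinuousOn h M) (hinj : Set.InjOn h M)
    (hrange : A '' M ⊆ h '' M) : ∃ u ∈ M, h u = A u := by
  have : CompactSpace M := isCompact_iff_compactSpace.1 hcpt
  have hemb : IsClosedEmbedding (M.domRestrict h) :=
    (continuousOn_iff_continuous_domRestrict.1 hh).isClosedEmbedding (Set.injOn_iff_injective.1 hinj)
  have hex : ∀ v : M, ∃ w : M, M.domRestrict h w = M.domRestrict A v := by
    intro v
    obtain ⟨w, hw, hwv⟩ := hrange ⟨v, v.2, rfl⟩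
    exact ⟨⟨w, hw⟩, hwv⟩
  -- Here `f = h⁻¹ ∘ A`, continuous because `h` embeds `M`.
  choose f hf using hex
  have hfc : Continuous f := by
    rw [hemb.isEmbedding.continuous_iff, show M.domRestrict h ∘ f = M.domRestrict A from funext hf]
    exact continuousOn_iff_continuous_domRestrict.1 hA
  obtain ⟨u, hu⟩ := exists_fixedPoint_of_isCompact_convex hne hcpt hconv hfc
  have := hf u
  rw [hu] at this
  exact ⟨u, u.2, this⟩

end Schauder

/-! ### Passage to the limit `λₙ → 1` -/

/-- Only the values of `A` on `M` and of `B` on its domain `D ⊇ M` matter. -/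
theorem corollary2p3
    {𝕜 : Type*} [RCLike 𝕜]
    {X : Type*} [AddCommGroup X] [Module 𝕜 X] [Module ℝ X] [IsScalarTower ℝ 𝕜 X]
    [TopologicalSpace X] [IsTopologicalAddGroup X] [ContinuousSMul 𝕜 X]
    [LocallyConvexSpace ℝ X] [T2Space X]
    (M D : Set X) (hMne : M.Nonempty) (hMcpt : IsCompact M) (hMconv : Convex ℝ M)
    (hMD : M ⊆ D)
    (A B : X → X) (hA : ContinuousOn A M) (hB : ContinuousOn B M)
    (lam : ℕ → 𝕜) (hlam : Tendsto lam atTop (𝓝 1))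
    (hinj : ∀ n, Set.InjOn (fun x => x - lam n • B x) M)
    (hrange : ∀ n, A '' M ⊆ (fun x => x - lam n • B x) '' M)
    (hinv : ∀ n, ∀ u ∈ D, ∀ v ∈ M, u = lam n • B u + A v → u ∈ M) :
    ∃ u ∈ M, A u + B u = u := by
  have : ContinuousSMul ℝ X := IsScalarTower.continuousSMul 𝕜
  have hex : ∀ n, ∃ u ∈ M, u - lam n • B u = A u := fun n =>
    exists_eq_of_injOn_of_image_subset hMne hMcpt hMconv hA
      (continuousOn_id.sub (hB.const_smul (lam n))) (hinj n) (hrange n)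
  choose u huM hu using hex
  -- `X` need not be metrizable, so `u` may lack a convergent subsequence; along an ultrafilter it
  -- converges in the compact set `M`.
  let U : Ultrafilter ℕ := hyperfilter ℕ
  have hU : (U : Filter ℕ) ≤ atTop := Nat.hyperfilter_le_atTop
  obtain ⟨x, hx, hux⟩ := hMcpt.ultrafilter_le_nhds (U.map u)
    (le_principal_iff.2 (Filter.mem_map.2 (Filter.univ_mem' huM)))
  have hux : Tendsto u U (𝓝 x) := hux
  have hux' : Tendsto u U (𝓝[M] x) :=
    tendsto_nhdsWithin_iff.2 ⟨hux, Filter.Eventually.of_forall huM⟩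
  have h1 : Tendsto (fun n => A (u n)) U (𝓝 (A x)) := (hA x hx).tendsto.comp hux'
  have h2 : Tendsto (fun n => u n - lam n • B (u n)) U (𝓝 (x - (1 : 𝕜) • B x)) :=
    hux.sub ((hlam.mono_left hU).smul ((hB x hx).tendsto.comp hux'))
  have h3 := tendsto_nhds_unique (h1.congr fun n => (hu n).symm) h2
  rw [one_smul] at h3
  exact ⟨x, hx, by rw [h3, sub_add_cancel]⟩
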